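/- A *relative semicategory* is a small semicategory (a category without the identity structure: morphisms with an associative composition) together with a wide subsemicategory of marked morphisms, i.e. a class of morphisms closed under composition; $\mathsf{RelSemiCat}$ is their category, with marking-preserving semicategory functors. A *relative graph* is a small directed graph together with a wide subgraph of marked edges; $\mathsf{RelGraph}$ is their category, with marking-preserving graph morphisms. The category *fat Delta* $\underline{\Delta}$ has as objects the epimorphisms $\eta\colon [m]\twoheadrightarrow[n]$ of the simplex category $\Delta$, and as morphisms $\eta_0\to\eta_1$ the commutative squares $(\overline f\colon[m_0]\to[m_1],\ \underline f\colon[n_0]\to[n_1])$, $\eta_1\overline f=\underline f\eta_0$, in $\Delta$ with $\overline f$ a monomorphism. Let $j\colon\underline{\Delta}_0\hookrightarrow\underline{\Delta}$ be the wide subcategory of the squares with $\overline f$ inert, i.e. $\overline f(k+1)=\overline f(k)+1$ for all $0\le k<m_0$. Let $i\colon\underline{\Delta}\to\mathsf{RelSemiCat}$ send $\eta\colon[m]\twoheadrightarrow[n]$ to the semicategory with objects $0,\dots,m$ and exactly one morphism $a\to b$ if $a<b$ and none otherwise, this morphism being marked if and only if $\eta(a)=\eta(b)$. Let $i_0\colon\underline{\Delta}_0\to\mathsf{RelGraph}$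 send $\eta$ to the linear graph with vertices $0,\dots,m$ and one edge $a\to a+1$ for each $0\le a<m$, marked if and only if $\eta(a)=\eta(a+1)$. On morphisms both act through $\overline f$. For a category $\mathcal C$, write $\mathrm{Psh}(\mathcal C)$ for the category of presheaves of sets on $\mathcal C$. The nerve functors are $$\underline{\mathcal N}\colon\mathsf{RelSemiCat}\to\mathrm{Psh}(\underline{\Delta}),\quad \underline{\mathcal N}(\mathcal C)=\mathsf{RelSemiCat}(i(-),\mathcal C),\qquad \underline{\mathcal N}_0\colon\mathsf{RelGraph}\to\mathrm{Psh}(\underline{\Delta}_0),\quad \underline{\mathcal N}_0(X)=\mathsf{RelGraph}(i_0(-),X).$$ **Theorem.** The nerve functor $\underline{\mathcal N}\colon\mathsf{RelSemiCat}\to\mathrm{Psh}(\underline{\Delta})$ is fully faithful. A presheaf $P$ on $\underline{\Delta}$ belongs to its essential image if and only if its restriction $j^*P$ along $j\colon\underline{\Delta}_0\hookrightarrow\underline{\Delta}$ belongs to the essential image of $\underline{\mathcal N}_0\colon\mathsf{RelGraph}\to\mathrm{Psh}(\underline{\Delta}_0)$ (the Segal condition). -/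

import Mathlib

open CategoryTheory

universe v u

/-- A semicategory structure on a type of objects: morphisms with an associative composition,
and no identities. -/
class Semicategory (C : Type u) extends Quiver.{v} C where
  /-- composition, in diagrammatic order -/
  comp {a b c : C} (f : a ⟶ b) (g : b ⟶ c) : a ⟶ c
  assoc {a b c d : C} (f : a ⟶ b) (g : b ⟶ c) (h : c ⟶ d) :
    comp (comp f g) h = comp f (comp g h)

/-- A small relative semicategory: a small semicategory with a wide subsemicategory of marked
morphisms, i.e. a class of morphisms closed under composition. -/
structure RelSemiCat : Type (u + 1) where
  Obj : Type u
  [semicategory : Semicategory.{u} Obj]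
  marked : WideSubquiver Obj
  comp_mem {a b c : Obj} (f : a ⟶ b) (g : b ⟶ c) :
    f ∈ marked a b → g ∈ marked b c → Semicategory.comp f g ∈ marked a c

/-- A small relative graph: a small directed graph (quiver) with a wide subgraph of marked
edges. -/
structure RelGraph : Type (u + 1) where
  Vert : Type u
  [quiver : Quiver.{u} Vert]
  marked : WideSubquiver Vert

attribute [instance] RelSemiCat.semicategory RelGraph.quiver

namespace RelSemiCat

/-- Marking preserving semicategory functors. -/
@[ext]
structure Hom (C D : RelSemiCat.{u}) extends C.Obj ⥤q D.Obj where
  map_comp {a b c : C.Obj} (f : a ⟶ b) (g : b ⟶ c) :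
    map (Semicategory.comp f g) = Semicategory.comp (map f) (map g)
  map_mem {a b : C.Obj} (f : a ⟶ b) : f ∈ C.marked a b → map f ∈ D.marked (obj a) (obj b)

/-- The category of small relative semicategories. -/
instance : Category.{u} RelSemiCat.{u} where
  Hom := Hom
  id C :=
    { toPrefunctor := 𝟭q C.Obj
      map_comp := fun _ _ => rfl
      map_mem := fun _ h => h }
  comp F G :=
    { toPrefunctor := F.toPrefunctor ⋙q G.toPrefunctor
      map_comp := fun f g => (congrArg G.map (F.map_comp f g)).trans (G.map_comp _ _)
      map_mem := fun f h => G.map_mem _ (F.map_mem f h) }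

end RelSemiCat

namespace RelGraph

/-- Marking preserving graph morphisms. -/
@[ext]
structure Hom (X Y : RelGraph.{u}) extends X.Vert ⥤q Y.Vert where
  map_mem {a b : X.Vert} (f : a ⟶ b) : f ∈ X.marked a b → map f ∈ Y.marked (obj a) (obj b)

/-- The category of small relative graphs. -/
instance : Category.{u} RelGraph.{u} where
  Hom := Hom
  id X :=
    { toPrefunctor := 𝟭q X.Vert
      map_mem := fun _ h => h }
  comp F G :=
    { toPrefunctor := F.toPrefunctor ⋙q G.toPrefunctor
      map_mem := fun f h => G.map_mem _ (F.map_mem f h) }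

end RelGraph

/-- Objects of fat Delta: epimorphisms `dom ↠ cod` of the simplex category. -/
structure FatDelta : Type where
  dom : SimplexCategory
  cod : SimplexCategory
  hom : dom ⟶ cod
  epi : Epi hom

namespace FatDelta

/-- Morphisms of fat Delta: commutative squares in the simplex category between the two
epimorphisms, whose top arrow is a monomorphism. -/
@[ext]
structure Hom (η θ : FatDelta) : Type where
  top : η.dom ⟶ θ.dom
  bot : η.cod ⟶ θ.cod
  mono : Mono top
  w : top ≫ θ.hom = η.hom ≫ bot

/-- The category fat Delta. -/
instance : Category.{0} FatDelta where
  Hom := Hom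
  id η :=
    { top := 𝟙 _
      bot := 𝟙 _
      mono := inferInstance
      w := by simp }
  comp {η θ κ} f g :=
    { top := f.top ≫ g.top
      bot := f.bot ≫ g.bot
      mono := by
        have := f.mono
        have := g.mono
        exact mono_comp _ _
      w := by rw [Category.assoc, g.w, ← Category.assoc, f.w, Category.assoc] }
  id_comp f := Hom.ext (Category.id_comp _) (Category.id_comp _)
  comp_id f := Hom.ext (Category.comp_id _) (Category.comp_id _)
  assoc f g h := Hom.ext (Category.assoc _ _ _) (Category.assoc _ _ _)

/-- The position in `dom` of the image of a position under the top arrow of a morphism. -/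
def topFun {η θ : FatDelta} (f : η ⟶ θ) : Fin (η.dom.len + 1) → Fin (θ.dom.len + 1) :=
  f.top.toOrderHom

/-- An edge or arrow from `a` to `b` is collapsed by `η` if `η a = η b`; these are the ones
that get marked. -/
def Collapses (η : FatDelta) (a b : Fin (η.dom.len + 1)) : Prop :=
  η.hom.toOrderHom a = η.hom.toOrderHom b

lemma topFun_lt {η θ : FatDelta} (f : η ⟶ θ) {a b : Fin (η.dom.len + 1)} (h : a < b) :
    topFun f a < topFun f b :=
  (f.top.toOrderHom.monotone.strictMono_of_injective
    (SimplexCategory.mono_iff_injective.1 f.mono)) h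

lemma topFun_collapses {η θ : FatDelta} (f : η ⟶ θ) {a b : Fin (η.dom.len + 1)}
    (h : η.Collapses a b) : θ.Collapses (topFun f a) (topFun f b) := by
  have key (c : Fin (η.dom.len + 1)) :
      θ.hom.toOrderHom (topFun f c) = f.bot.toOrderHom (η.hom.toOrderHom c) :=
    congrArg (fun k : η.dom ⟶ θ.cod => k.toOrderHom c) f.w
  unfold Collapses at h ⊢
  rw [key, key, h]

/-- The inert morphisms of fat Delta: those whose top arrow is inert, i.e. distance preserving. -/
def inert : MorphismProperty FatDelta := fun η _ f =>
  ∀ a b : Fin (η.dom.len + 1), (b : ℕ) = (a : ℕ) + 1 → (topFun f b : ℕ) = (topFun f a : ℕ) + 1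

instance : inert.IsMultiplicative where
  id_mem _ _ _ h := h
  comp_mem f _ hf hg a b h := hg (topFun f a) (topFun f b) (hf a b h)

/-- The objects of the linear semicategory on an object of fat Delta. -/
structure SemiVertex (η : FatDelta) : Type u where
  pos : Fin (η.dom.len + 1)

/-- The linear semicategory: exactly one morphism `a ⟶ b` if `a < b`, and none otherwise. -/
instance (η : FatDelta) : Semicategory.{u} (SemiVertex.{u} η) where
  Hom a b := ULift.{u} (PLift (a.pos < b.pos))
  comp f g := ⟨⟨lt_trans f.down.down g.down.down⟩⟩
  assoc _ _ _ := rfl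

/-- The vertices of the linear graph on an object of fat Delta. -/
structure GraphVertex (η : FatDelta) : Type u where
  pos : Fin (η.dom.len + 1)

/-- The linear graph: exactly one edge `a ⟶ b` if `b = a + 1`, and none otherwise. -/
instance (η : FatDelta) : Quiver.{u} (GraphVertex.{u} η) where
  Hom a b := ULift.{u} (PLift ((b.pos : ℕ) = (a.pos : ℕ) + 1))

/-- The functor from fat Delta to relative semicategories: `η : [m] ↠ [n]` goes to the linear
semicategory on `[m]`, an arrow being marked when `η` sends it to an identity; a morphism acts
through its top arrow. -/
def toRelSemiCat : FatDelta ⥤ RelSemiCat.{u} where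
  obj η :=
    { Obj := SemiVertex.{u} η
      marked := fun a b => {_f | η.Collapses a.pos b.pos}
      comp_mem := fun _ _ hf hg => Eq.trans hf hg }
  map f :=
    { obj := fun a => ⟨topFun f a.pos⟩
      map := fun e => ⟨⟨topFun_lt f e.down.down⟩⟩
      map_comp := fun _ _ => rfl
      map_mem := fun _ h => topFun_collapses f h }

end FatDelta

/-- The wide subcategory of fat Delta on the inert morphisms. -/
abbrev FatDeltaInert : Type := WideSubcategory FatDelta.inert

namespace FatDeltaInert

/-- The inclusion of the inert subcategory in fat Delta. -/
abbrev incl : FatDeltaInert ⥤ FatDelta := wideSubcategoryInclusion FatDelta.inert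

/-- The functor from the inert part of fat Delta to relative graphs: `η : [m] ↠ [n]` goes to the
linear graph of length `m`, an edge being marked when `η` collapses it; a morphism acts through
its top arrow. -/
def toRelGraph : FatDeltaInert ⥤ RelGraph.{u} where
  obj η :=
    { Vert := FatDelta.GraphVertex.{u} η.obj
      marked := fun a b => {_f | η.obj.Collapses a.pos b.pos} }
  map f :=
    { obj := fun a => ⟨FatDelta.topFun f.hom a.pos⟩
      map := fun {a b} e => ⟨⟨f.property a.pos b.pos e.down.down⟩⟩
      map_mem := fun _ h => FatDelta.topFun_collapses f.hom h }

end FatDeltaInert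

/-- The nerve of relative semicategories: `C ↦ (η ↦ Hom (toRelSemiCat η, C))`. -/
def RelSemiCat.nerve : RelSemiCat.{u} ⥤ (FatDeltaᵒᵖ ⥤ Type u) :=
  yoneda ⋙ (Functor.whiskeringLeft _ _ _).obj FatDelta.toRelSemiCat.{u}.op

/-- The nerve of relative graphs: `X ↦ (η ↦ Hom (toRelGraph η, X))`. -/
def RelGraph.nerve : RelGraph.{u} ⥤ (FatDeltaInertᵒᵖ ⥤ Type u) :=
  yoneda ⋙ (Functor.whiskeringLeft _ _ _).obj FatDeltaInert.toRelGraph.{u}.op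

/-! The linear semicategory on `[m]` is free on the linear graph of length `m`, and since the fibres
of a monotone map are convex and markings are closed under composition, it is enough to mark the
collapsed edges (`linearEquiv`). Hence the restricted nerve of `C` is the nerve of its underlying
relative graph, which gives one direction of the characterisation.

Full faithfulness holds because objects, arrows, composable pairs and marked arrows of `C` are
diagrams on `minimal 0`, `minimal 1`, `minimal 2` and `maximal 1`. A map of nerves therefore acts on
each of them, and naturality makes these actions a marking-preserving functor.

For the converse, `isSegal_of_iso` turns the hypothesis on the restriction into a statement about
elements: an element of `P` over `η` is the same as a chain of consecutive arrows of `P` whose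
collapsed members are marked. Filling chains of length two gives composition, length three gives
associativity, and `maximal 2` gives closure of the marking. The resulting relative semicategory has
nerve `P` (`isoNerve`), because the values on long arrows are forced by those on consecutive ones.
-/

namespace FatDelta

/-! ### Morphisms of fat Delta and its small objects. -/

lemma hom_ext {η θ : FatDelta} {f g : η ⟶ θ} (h : ∀ a, topFun f a = topFun g a) : f = g := by
  have htop : f.top = g.top := by
    ext a : 3
    exact h a
  refine Hom.ext htop ?_
  have := η.epi
  rw [← cancel_epi η.hom, ← f.w, ← g.w, htop]

lemma hom_surjective (η : FatDelta) : Function.Surjective η.hom.toOrderHom :=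
  SimplexCategory.epi_iff_surjective.1 η.epi

/-- A morphism of fat Delta from a strictly monotone map preserving collapsed pairs. -/
noncomputable def homMk {η θ : FatDelta} (f : Fin (η.dom.len + 1) → Fin (θ.dom.len + 1))
    (hf : StrictMono f) (hc : ∀ a b, η.Collapses a b → θ.Collapses (f a) (f b)) : η ⟶ θ where
  top := SimplexCategory.Hom.mk ⟨f, hf.monotone⟩
  bot := SimplexCategory.Hom.mk
    ⟨fun y => θ.hom.toOrderHom (f (Function.surjInv η.hom_surjective y)), fun y z hyz => by
      -- Chosen preimages of `y < z` cannot come in the reverse order, as `η` is monotone.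
      rcases hyz.eq_or_lt with rfl | h
      · exact le_rfl
      · refine θ.hom.toOrderHom.monotone (hf.monotone (le_of_not_gt fun hlt => ?_))
        have := η.hom.toOrderHom.monotone hlt.le
        rw [Function.surjInv_eq η.hom_surjective, Function.surjInv_eq η.hom_surjective] at this
        exact absurd h this.not_gt⟩
  mono := SimplexCategory.mono_iff_injective.2 hf.injective
  w := by
    ext a : 3
    exact hc _ _ (Function.surjInv_eq η.hom_surjective _).symm

/-- Fibres of a monotone map are convex. -/
lemma Collapses.of_le {η : FatDelta} {a b c d : Fin (η.dom.len + 1)} (h : η.Collapses a d)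
    (hab : a ≤ b) (hbc : b ≤ c) (hcd : c ≤ d) : η.Collapses b c := by
  have h1 := η.hom.toOrderHom.monotone hab
  have h2 := η.hom.toOrderHom.monotone hbc
  have h3 := η.hom.toOrderHom.monotone hcd
  unfold Collapses at h ⊢
  rw [← h] at h3
  exact le_antisymm h2 (h3.trans h1)

/-- The linear object of length `m` with no marked arrows. -/
def minimal (m : ℕ) : FatDelta := ⟨.mk m, .mk m, 𝟙 _, inferInstance⟩

/-- The linear object of length `m` with all arrows marked. -/
def maximal (m : ℕ) : FatDelta :=
  ⟨.mk m, .mk 0, SimplexCategory.Hom.mk ⟨fun _ => 0, fun _ _ _ => le_rfl⟩,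
    SimplexCategory.epi_iff_surjective.2 fun _ => ⟨0, (Subsingleton.elim (α := Fin 1) _ _)⟩⟩

/-- A strictly monotone map, as a morphism from a minimally marked object. -/
noncomputable def ofMinimal {m : ℕ} {η : FatDelta} (f : Fin (m + 1) → Fin (η.dom.len + 1))
    (hf : StrictMono f) : minimal m ⟶ η :=
  homMk (η := minimal m) f hf fun _ _ h => congrArg (fun x => η.hom.toOrderHom (f x)) h

/-- A strictly monotone map with collapsed image, as a morphism from a maximally marked object. -/
noncomputable def ofMaximal {m : ℕ} {η : FatDelta} (f : Fin (m + 1) → Fin (η.dom.len + 1))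
    (hf : StrictMono f) (hc : ∀ a b, η.Collapses (f a) (f b)) : maximal m ⟶ η :=
  homMk (η := maximal m) f hf fun a b _ => hc a b

/-- A position, as a morphism from the point. -/
noncomputable def vertex {η : FatDelta} (a : Fin (η.dom.len + 1)) : minimal 0 ⟶ η :=
  ofMinimal (fun _ => a) (Subsingleton.strictMono (α := Fin 1) _)

/-- An increasing pair of positions, as a morphism from the free arrow. -/
noncomputable def arrow {η : FatDelta} {a b : Fin (η.dom.len + 1)} (h : a < b) : minimal 1 ⟶ η :=
  ofMinimal ![a, b] (by simpa [Fin.strictMono_iff_lt_succ] using h)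

/-- An increasing triple of positions, as a morphism from the free triangle. -/
noncomputable def triangle {η : FatDelta} {a b c : Fin (η.dom.len + 1)} (h : a < b) (h' : b < c) :
    minimal 2 ⟶ η :=
  ofMinimal ![a, b, c] (by simpa [Fin.strictMono_iff_lt_succ, Fin.forall_fin_two] using ⟨h, h'⟩)

/-- An increasing pair of collapsed positions, as a morphism from the marked arrow. -/
noncomputable def markedArrow {η : FatDelta} {a b : Fin (η.dom.len + 1)} (h : a < b)
    (hc : η.Collapses a b) : maximal 1 ⟶ η :=
  ofMaximal ![a, b] (by simpa [Fin.strictMono_iff_lt_succ] using h) (by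
    simpa [Fin.forall_fin_two] using ⟨⟨rfl, hc⟩, hc.symm, rfl⟩)

/-- The morphism from the free arrow to the marked arrow. -/
noncomputable def mark : minimal 1 ⟶ maximal 1 := ofMinimal (η := maximal 1) id strictMono_id

lemma vertex_comp {η θ : FatDelta} (a : Fin (η.dom.len + 1)) (f : η ⟶ θ) :
    vertex a ≫ f = vertex (topFun f a) := hom_ext fun _ => rfl

lemma arrow_comp {η θ : FatDelta} {a b : Fin (η.dom.len + 1)} (h : a < b) (f : η ⟶ θ) :
    arrow h ≫ f = arrow (topFun_lt f h) :=
  hom_ext (Fin.forall_fin_two.2 ⟨rfl, rfl⟩)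

lemma mark_comp_markedArrow {η : FatDelta} {a b : Fin (η.dom.len + 1)} (h : a < b)
    (hc : η.Collapses a b) : mark ≫ markedArrow h hc = arrow h :=
  hom_ext fun _ => rfl

end FatDelta

/-! ### Composites of chains of arrows. -/

namespace Semicategory

variable {C : Type u} [Semicategory.{v} C] {n : ℕ}

/-- The composite of the consecutive arrows `e` from position `a` to position `b`. -/
def path (v : Fin n → C) (e : ∀ a b : Fin n, (b : ℕ) = a + 1 → (v a ⟶ v b)) :
    ∀ (b : ℕ) (hb : b < n) (a : Fin n), (a : ℕ) < b → (v a ⟶ v ⟨b, hb⟩)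
  | 0, _, _, h => absurd h (Nat.not_lt_zero _)
  | b + 1, hb, a, h =>
    if h' : (a : ℕ) < b then
      comp (path v e b (Nat.lt_of_succ_lt hb) a h') (e ⟨b, Nat.lt_of_succ_lt hb⟩ ⟨b + 1, hb⟩ rfl)
    else e a ⟨b + 1, hb⟩ (congrArg (· + 1) (le_antisymm (not_lt.1 h') (Nat.lt_succ_iff.1 h)))

variable (v : Fin n → C) (e : ∀ a b : Fin n, (b : ℕ) = a + 1 → (v a ⟶ v b))

lemma path_succ {b : ℕ} (hb : b < n) (a : Fin n) (h : (a : ℕ) < b) (h' : b = a + 1) :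
    path v e b hb a h = e a ⟨b, hb⟩ h' := by
  subst h'
  exact dif_neg (lt_irrefl _)

/-- Paths are bracketed to the left, so induction on the end point needs one use of associativity
per step. -/
lemma path_comp {a b : Fin n} (hab : a < b) {c : ℕ} (hc : c < n) (hbc : (b : ℕ) < c) :
    comp (path v e b b.2 a hab) (path v e c hc b hbc) =
      path v e c hc a (lt_trans (Fin.lt_def.1 hab) hbc) := by
  induction c with
  | zero => exact absurd hbc (Nat.not_lt_zero _)
  | succ c ih =>
    rw [path, path, dif_pos (show (a : ℕ) < c from lt_of_lt_of_le hab (Nat.lt_succ_iff.1 hbc))]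
    split_ifs with h
    · rw [← assoc, ih]
    · obtain rfl : (b : ℕ) = c := le_antisymm (Nat.lt_succ_iff.1 hbc) (not_lt.1 h)
      rfl

/-- Uniqueness half of freeness: a family compatible with composition is determined by its
consecutive arrows. -/
lemma path_eq (m : ∀ a b : Fin n, a < b → (v a ⟶ v b))
    (hm : ∀ a b c (h : a < b) (h' : b < c), m a c (h.trans h') = comp (m a b h) (m b c h'))
    (he : ∀ a b h, e a b h = m a b (Fin.lt_def.2 (h ▸ Nat.lt_succ_self _)))
    {b : ℕ} (hb : b < n) (a : Fin n) (h : (a : ℕ) < b) :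
    path v e b hb a h = m a ⟨b, hb⟩ h := by
  induction b with
  | zero => exact absurd h (Nat.not_lt_zero _)
  | succ b ih =>
    rw [path]
    split_ifs with h'
    · rw [ih, he, ← hm]
    · rw [he]

end Semicategory

/-! ### Arrows bundled with their end points, so that equality makes sense when end points agree
only propositionally. -/

namespace Quiver.Total

variable {V : Type*} [Quiver V]

lemma exists_mk_eq (t : Quiver.Total V) {a b : V} (ha : t.left = a) (hb : t.right = b) :
    ∃ g : a ⟶ b, (⟨_, _, g⟩ : Quiver.Total V) = t := by
  subst ha hb
  exact ⟨t.hom, rfl⟩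

lemma mem_of_mk_eq {S : WideSubquiver V} {a b a' b' : V} {f : a ⟶ b} {f' : a' ⟶ b'}
    (h : (⟨_, _, f⟩ : Quiver.Total V) = ⟨_, _, f'⟩) (hf : f ∈ S a b) : f' ∈ S a' b' := by
  cases h
  exact hf

end Quiver.Total

namespace RelGraph

lemma hom_ext {X Y : RelGraph.{u}} {F G : X ⟶ Y}
    (hobj : ∀ a, (Hom.toPrefunctor F).obj a = (Hom.toPrefunctor G).obj a)
    (hmap : ∀ {a b} (f : a ⟶ b),
      (⟨_, _, (Hom.toPrefunctor F).map f⟩ : Quiver.Total Y.Vert) =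
        ⟨_, _, (Hom.toPrefunctor G).map f⟩) : F = G := by
  obtain ⟨⟨F, F'⟩, h1⟩ := F
  obtain ⟨⟨G, G'⟩, h3⟩ := G
  obtain rfl : F = G := funext hobj
  obtain rfl : @F' = @G' := by
    funext a b f
    have := hmap f
    simpa using this
  rfl

end RelGraph

namespace RelSemiCat

variable {C D : RelSemiCat.{u}}

/-- The underlying prefunctor of a morphism of relative semicategories. -/
abbrev prefunctor (F : C ⟶ D) : C.Obj ⥤q D.Obj := Hom.toPrefunctor F

lemma hom_ext {F G : C ⟶ D} (hobj : ∀ a, (prefunctor F).obj a = (prefunctor G).obj a)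
    (hmap : ∀ {a b} (f : a ⟶ b), (⟨_, _, (prefunctor F).map f⟩ : Quiver.Total D.Obj) =
      ⟨_, _, (prefunctor G).map f⟩) : F = G := by
  obtain ⟨⟨F, F'⟩, h1, h2⟩ := F
  obtain ⟨⟨G, G'⟩, h3, h4⟩ := G
  obtain rfl : F = G := funext hobj
  obtain rfl : @F' = @G' := by
    funext a b f
    have := hmap f
    simpa using this
  rfl

/-- The relative graph underlying a relative semicategory. -/
def toRelGraph (C : RelSemiCat.{u}) : RelGraph.{u} where
  Vert := C.Obj
  marked := C.marked

end RelSemiCat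

/-! ### The linear semicategory is free on the linear graph. -/

namespace FatDelta

open Semicategory

variable {η : FatDelta} {C : RelSemiCat.{u}}

/-- A linear diagram of consecutive arrows in a relative semicategory, marked over the collapsed
edges, extends to the linear semicategory. -/
def lift (v : Fin (η.dom.len + 1) → C.Obj)
    (e : ∀ a b : Fin (η.dom.len + 1), (b : ℕ) = a + 1 → (v a ⟶ v b))
    (hm : ∀ a b h, η.Collapses a b → e a b h ∈ C.marked (v a) (v b)) :
    toRelSemiCat.{u}.obj η ⟶ C :=
  RelSemiCat.Hom.mk
    { obj := fun a => v a.pos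
      map := fun {a b} f => path v e b.pos b.pos.2 a.pos f.down.down }
    (fun f g => (path_comp v e f.down.down _ g.down.down).symm)
    (by
      rintro ⟨a⟩ ⟨b, hb⟩ ⟨⟨h⟩⟩ hc
      change (a : ℕ) < b at h
      change η.Collapses a ⟨b, hb⟩ at hc
      change path v e b hb a h ∈ C.marked (v a) (v ⟨b, hb⟩)
      induction b with
      | zero => exact absurd h (Nat.not_lt_zero _)
      | succ b ih =>
        rw [path]
        split_ifs with h'
        · exact C.comp_mem _ _
            (ih (Nat.lt_of_succ_lt hb) h'
              (hc.of_le le_rfl (Fin.le_def.2 h'.le) (Fin.le_def.2 (Nat.le_succ b))))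
            (hm _ _ _ (hc.of_le (Fin.le_def.2 h'.le) (Fin.le_def.2 (Nat.le_succ b)) le_rfl))
        · exact hm _ _ _ hc)

lemma prefunctor_lift_map (v : Fin (η.dom.len + 1) → C.Obj) (e hm)
    {a b : Fin (η.dom.len + 1)} (h : (b : ℕ) = a + 1) (h' : a < b) :
    (RelSemiCat.prefunctor (lift (η := η) (C := C) v e hm)).map
      (show (⟨a⟩ : SemiVertex η) ⟶ ⟨b⟩ from ⟨⟨h'⟩⟩) = e a b h :=
  path_succ v e b.2 a h' h

/-- Morphisms out of the linear semicategory are morphisms out of the linear graph. -/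
def linearEquiv (η : FatDeltaInert) (C : RelSemiCat.{u}) :
    (toRelSemiCat.{u}.obj η.obj ⟶ C) ≃ (FatDeltaInert.toRelGraph.{u}.obj η ⟶ C.toRelGraph) where
  toFun F := RelGraph.Hom.mk
    { obj := fun a => (RelSemiCat.prefunctor F).obj ⟨a.pos⟩
      map := fun {a b} f => (RelSemiCat.prefunctor F).map
        (show (⟨a.pos⟩ : SemiVertex η.obj) ⟶ ⟨b.pos⟩ from
          ⟨⟨Fin.lt_def.2 (f.down.down ▸ Nat.lt_succ_self _)⟩⟩) }
    (fun _ h => RelSemiCat.Hom.map_mem F _ h)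
  invFun G := lift (fun a => (RelGraph.Hom.toPrefunctor G).obj ⟨a⟩)
    (fun a b h => (RelGraph.Hom.toPrefunctor G).map
      (show (⟨a⟩ : GraphVertex η.obj) ⟶ ⟨b⟩ from ⟨⟨h⟩⟩))
    (fun _ _ _ h => RelGraph.Hom.map_mem G _ h)
  left_inv F := by
    refine RelSemiCat.hom_ext (fun _ => rfl) fun {a b} f => ?_
    refine congrArg (Quiver.Total.mk _ _) ?_
    exact path_eq (fun a => (RelSemiCat.prefunctor F).obj ⟨a⟩) _
      (fun a b h => (RelSemiCat.prefunctor F).map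
        (show (⟨a⟩ : SemiVertex η.obj) ⟶ ⟨b⟩ from ⟨⟨h⟩⟩))
      (fun a b c h h' => RelSemiCat.Hom.map_comp F
        (show (⟨a⟩ : SemiVertex η.obj) ⟶ ⟨b⟩ from ⟨⟨h⟩⟩)
        (show (⟨b⟩ : SemiVertex η.obj) ⟶ ⟨c⟩ from ⟨⟨h'⟩⟩))
      (fun _ _ _ => rfl) b.pos.2 a.pos f.down.down
  right_inv G := by
    refine RelGraph.Hom.ext rfl ?_
    refine heq_of_eq ?_
    funext a b f
    exact path_succ _ _ _ _ _ f.down.down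

end FatDelta

/-- The restriction of the nerve of a relative semicategory is the nerve of its underlying
relative graph. -/
def RelSemiCat.restrictNerveIso (C : RelSemiCat.{u}) :
    FatDeltaInert.incl.op ⋙ RelSemiCat.nerve.obj C ≅ RelGraph.nerve.obj C.toRelGraph :=
  NatIso.ofComponents (fun η => (FatDelta.linearEquiv η.unop C).toIso) (fun _ => rfl)

namespace FatDelta

/-- An arrow of the linear semicategory. -/
def linearArrow {η : FatDelta} {a b : Fin (η.dom.len + 1)} (h : a < b) :
    (⟨a⟩ : SemiVertex.{u} η) ⟶ ⟨b⟩ := ⟨⟨h⟩⟩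

end FatDelta

/-! ### The nerve is fully faithful. -/

namespace RelSemiCat

open FatDelta Opposite

variable {C D : RelSemiCat.{u}}

lemma total_comp_eq {a b c a' b' c' : C.Obj} {f : a ⟶ b} {g : b ⟶ c} {f' : a' ⟶ b'}
    {g' : b' ⟶ c'} (hf : (⟨_, _, f⟩ : Quiver.Total C.Obj) = ⟨_, _, f'⟩)
    (hg : (⟨_, _, g⟩ : Quiver.Total C.Obj) = ⟨_, _, g'⟩) :
    (⟨_, _, Semicategory.comp f g⟩ : Quiver.Total C.Obj) = ⟨_, _, Semicategory.comp f' g'⟩ := by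
  cases hf
  cases hg
  rfl

/-- An object, as a morphism from the linear semicategory on a point. -/
def point (x : C.Obj) : toRelSemiCat.{u}.obj (minimal 0) ⟶ C :=
  lift (η := minimal 0) (fun _ => x) (fun a b h => absurd h (by
    have : a = b := Subsingleton.elim (α := Fin 1) a b
    omega)) (fun a b h => absurd h (by
    have : a = b := Subsingleton.elim (α := Fin 1) a b
    omega))

/-- The consecutive arrows of the diagram `x ⟶ y`. -/
def arrowDiagram {x y : C.Obj} (f : x ⟶ y) :
    ∀ i j : Fin 2, (j : ℕ) = i + 1 → (![x, y] i ⟶ ![x, y] j)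
  | 0, 1, _ => f
  | 0, 0, h => absurd h (by decide)
  | 1, 0, h => absurd h (by decide)
  | 1, 1, h => absurd h (by decide)

/-- The consecutive arrows of the diagram `x ⟶ y ⟶ z`. -/
def triangleDiagram {x y z : C.Obj} (f : x ⟶ y) (g : y ⟶ z) :
    ∀ i j : Fin 3, (j : ℕ) = i + 1 → (![x, y, z] i ⟶ ![x, y, z] j)
  | 0, 1, _ => f
  | 1, 2, _ => g
  | 0, 0, h => absurd h (by decide)
  | 0, 2, h => absurd h (by decide)
  | 1, 0, h => absurd h (by decide)
  | 1, 1, h => absurd h (by decide)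
  | 2, 0, h => absurd h (by decide)
  | 2, 1, h => absurd h (by decide)
  | 2, 2, h => absurd h (by decide)

lemma mem_marked_of_collapses_minimal {m : ℕ} {v : Fin (m + 1) → C.Obj}
    (e : ∀ i j : Fin (m + 1), (j : ℕ) = i + 1 → (v i ⟶ v j)) (a b : Fin (m + 1))
    (h : (b : ℕ) = a + 1) (hc : (minimal m).Collapses a b) : e a b h ∈ C.marked (v a) (v b) := by
  have : a = b := hc
  omega

/-- An arrow, as a morphism from the linear semicategory on the free arrow. -/
def single {x y : C.Obj} (f : x ⟶ y) : toRelSemiCat.{u}.obj (minimal 1) ⟶ C :=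
  lift (η := minimal 1) ![x, y] (arrowDiagram f) (mem_marked_of_collapses_minimal _)

/-- A composable pair, as a morphism from the linear semicategory on the free triangle. -/
def pair {x y z : C.Obj} (f : x ⟶ y) (g : y ⟶ z) : toRelSemiCat.{u}.obj (minimal 2) ⟶ C :=
  lift (η := minimal 2) ![x, y, z] (triangleDiagram f g) (mem_marked_of_collapses_minimal _)

/-- A marked arrow, as a morphism from the linear semicategory on the marked arrow. -/
def markedSingle {x y : C.Obj} (f : x ⟶ y) (hf : f ∈ C.marked x y) :
    toRelSemiCat.{u}.obj (maximal 1) ⟶ C :=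
  lift (η := maximal 1) ![x, y] (arrowDiagram f) (fun
    | 0, 1, _, _ => hf
    | 0, 0, h, _ => absurd h (by decide)
    | 1, 0, h, _ => absurd h (by decide)
    | 1, 1, h, _ => absurd h (by decide))

lemma lt01 : (0 : Fin ((minimal 1).dom.len + 1)) < (1 : Fin 2) := Fin.zero_lt_one (n := 0)

lemma single_map {x y : C.Obj} (f : x ⟶ y) :
    (prefunctor (single f)).map (linearArrow (η := minimal 1) lt01) = f :=
  prefunctor_lift_map (η := minimal 1) _ (arrowDiagram f) _ rfl lt01

lemma vertex_comp_hom {η : FatDelta} (F : toRelSemiCat.{u}.obj η ⟶ C) (a) :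
    toRelSemiCat.{u}.map (vertex a) ≫ F = point ((prefunctor F).obj ⟨a⟩) :=
  hom_ext (fun _ => rfl) fun {a b} f => absurd f.down.down (by
    have : a.pos = b.pos := Subsingleton.elim (α := Fin 1) _ _
    exact this.not_lt)

lemma hom_minimal_one_ext {F G : toRelSemiCat.{u}.obj (minimal 1) ⟶ C}
    (h : (⟨_, _, (prefunctor F).map (linearArrow (η := minimal 1) lt01)⟩ : Quiver.Total C.Obj) =
      ⟨_, _, (prefunctor G).map (linearArrow (η := minimal 1) lt01)⟩) : F = G := by
  refine hom_ext ?_ ?_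
  · rintro ⟨a⟩
    change Fin 2 at a
    match a with
    | 0 => exact congrArg Quiver.Total.left h
    | 1 => exact congrArg Quiver.Total.right h
  · rintro ⟨a⟩ ⟨b⟩ ⟨⟨hab⟩⟩
    change Fin 2 at a b
    match a, b, hab with
    | 0, 1, _ => exact h
    | 0, 0, h => exact absurd h (lt_irrefl _)
    | 1, 0, h => exact absurd h (by decide)
    | 1, 1, h => exact absurd h (lt_irrefl _)

/-- With `vertex_comp_hom`, this lets naturality reduce a map of nerves on any diagram to its values
on `point` and `single`. -/
lemma arrow_comp_hom {η : FatDelta} (F : toRelSemiCat.{u}.obj η ⟶ C)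
    {a b : Fin (η.dom.len + 1)} (h : a < b) :
    toRelSemiCat.{u}.map (arrow h) ≫ F = single ((prefunctor F).map (linearArrow h)) :=
  hom_minimal_one_ext (by rw [single_map]; rfl)

lemma single_comp_map {x y : C.Obj} (f : x ⟶ y) (F : C ⟶ D) :
    (⟨_, _, (prefunctor (single f ≫ F)).map (linearArrow (η := minimal 1) lt01)⟩ :
      Quiver.Total D.Obj) = ⟨_, _, (prefunctor F).map f⟩ :=
  congrArg (fun g : x ⟶ y => (⟨_, _, (prefunctor F).map g⟩ : Quiver.Total D.Obj)) (single_map f)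

instance : nerve.{u}.Faithful where
  map_injective {C D F G} h := by
    have key (η : FatDelta) (K : toRelSemiCat.{u}.obj η ⟶ C) : K ≫ F = K ≫ G :=
      types_congr_hom (NatTrans.congr_app h (op η)) K
    refine hom_ext (fun x => ?_) fun {x y} f => ?_
    · exact congrArg (fun K : toRelSemiCat.{u}.obj (minimal 0) ⟶ D =>
        (prefunctor K).obj ⟨(0 : Fin 1)⟩) (key _ (point x))
    · have := congrArg (fun K : toRelSemiCat.{u}.obj (minimal 1) ⟶ D => (⟨_, _,
        (prefunctor K).map (linearArrow (η := minimal 1) lt01)⟩ : Quiver.Total D.Obj))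
          (key _ (single f))
      exact (single_comp_map f F).symm.trans (this.trans (single_comp_map f G))

section Full

variable (φ : nerve.{u}.obj C ⟶ nerve.{u}.obj D)

/-- The action of a map of nerves on diagrams. -/
def mapDiagram {η : FatDelta} (K : toRelSemiCat.{u}.obj η ⟶ C) : toRelSemiCat.{u}.obj η ⟶ D :=
  φ.app (op η) K

lemma map_comp_mapDiagram {η θ : FatDelta} (f : η ⟶ θ) (K : toRelSemiCat.{u}.obj θ ⟶ C) :
    mapDiagram φ (toRelSemiCat.{u}.map f ≫ K) = toRelSemiCat.{u}.map f ≫ mapDiagram φ K :=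
  types_congr_hom (φ.naturality f.op) K

/-- The action of a map of nerves on objects. -/
def mapObj (x : C.Obj) : D.Obj := (prefunctor (mapDiagram φ (point x))).obj ⟨(0 : Fin 1)⟩

/-- The action of a map of nerves on arrows. -/
def mapArrow {x y : C.Obj} (f : x ⟶ y) : Quiver.Total D.Obj :=
  ⟨_, _, (prefunctor (mapDiagram φ (single f))).map (linearArrow (η := minimal 1) lt01)⟩

variable {φ} in
lemma mapDiagram_obj {η : FatDelta} (K : toRelSemiCat.{u}.obj η ⟶ C) (a) :
    (prefunctor (mapDiagram φ K)).obj ⟨a⟩ = mapObj φ ((prefunctor K).obj ⟨a⟩) := by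
  rw [mapObj, ← vertex_comp_hom, map_comp_mapDiagram]
  rfl

variable {φ} in
lemma mapDiagram_map {η : FatDelta} (K : toRelSemiCat.{u}.obj η ⟶ C) {a b}
    (h : a < b) : (⟨_, _, (prefunctor (mapDiagram φ K)).map (linearArrow h)⟩ :
      Quiver.Total D.Obj) = mapArrow φ ((prefunctor K).map (linearArrow h)) := by
  rw [mapArrow, ← arrow_comp_hom, map_comp_mapDiagram]
  rfl

lemma exists_mapArrow {x y : C.Obj} (f : x ⟶ y) :
    ∃ g : mapObj φ x ⟶ mapObj φ y, (⟨_, _, g⟩ : Quiver.Total D.Obj) = mapArrow φ f :=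
  Quiver.Total.exists_mk_eq (mapArrow φ f) (mapDiagram_obj (single f) (0 : Fin 2))
    (mapDiagram_obj (single f) (1 : Fin 2))

/-- The prefunctor underlying a map of nerves. -/
noncomputable def mapPrefunctor : C.Obj ⥤q D.Obj where
  obj := mapObj φ
  map f := (exists_mapArrow φ f).choose

lemma mapPrefunctor_map {x y : C.Obj} (f : x ⟶ y) :
    (⟨_, _, (mapPrefunctor φ).map f⟩ : Quiver.Total D.Obj) = mapArrow φ f :=
  (exists_mapArrow φ f).choose_spec

/-- The image of `pair f g` is again a functor on the free triangle, so its long arrow is the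
composite of its two short ones; `mapDiagram_map` identifies all three. -/
lemma mapArrow_comp {x y z : C.Obj} (f : x ⟶ y) (g : y ⟶ z) :
    mapArrow φ (Semicategory.comp f g) =
      ⟨_, _, Semicategory.comp ((mapPrefunctor φ).map f) ((mapPrefunctor φ).map g)⟩ := by
  let p : Fin ((minimal 2).dom.len + 1) := (0 : Fin 3)
  let q : Fin ((minimal 2).dom.len + 1) := (1 : Fin 3)
  let r : Fin ((minimal 2).dom.len + 1) := (2 : Fin 3)
  have hpq : p < q := (by decide : (0 : Fin 3) < 1)
  have hqr : q < r := (by decide : (1 : Fin 3) < 2)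
  have hf : (prefunctor (pair f g)).map (linearArrow hpq) = f :=
    prefunctor_lift_map (η := minimal 2) _ (triangleDiagram f g) _ rfl hpq
  have hg : (prefunctor (pair f g)).map (linearArrow hqr) = g :=
    prefunctor_lift_map (η := minimal 2) _ (triangleDiagram f g) _ rfl hqr
  have hfg : (prefunctor (pair f g)).map (linearArrow (hpq.trans hqr)) =
      Semicategory.comp f g :=
    (Hom.map_comp (pair f g) (linearArrow hpq) (linearArrow hqr)).trans
      (congrArg₂ Semicategory.comp hf hg)
  have h1 := mapDiagram_map (φ := φ) (pair f g) hpq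
  have h2 := mapDiagram_map (φ := φ) (pair f g) hqr
  have h3 := mapDiagram_map (φ := φ) (pair f g) (hpq.trans hqr)
  rw [show mapArrow φ (Semicategory.comp f g) = _ from (congrArg (mapArrow φ) hfg).symm, ← h3]
  refine (congrArg (Quiver.Total.mk _ _) (Hom.map_comp (mapDiagram φ (pair f g))
    (linearArrow hpq) (linearArrow hqr))).trans (total_comp_eq ?_ ?_)
  · exact h1.trans ((congrArg (mapArrow φ) hf).trans (mapPrefunctor_map φ f).symm)
  · exact h2.trans ((congrArg (mapArrow φ) hg).trans (mapPrefunctor_map φ g).symm)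

/-- The morphism of relative semicategories underlying a map of nerves. -/
noncomputable def ofNerveMap : C ⟶ D :=
  Hom.mk (mapPrefunctor φ)
    (fun f g => by
      have := (mapPrefunctor_map φ (Semicategory.comp f g)).trans (mapArrow_comp φ f g)
      simpa using this)
    (fun f hf => by
      -- A marked arrow is a diagram on `maximal 1`, and so is its image, whose arrow is therefore
      -- marked.
      refine Quiver.Total.mem_of_mk_eq ?_ (Hom.map_mem (mapDiagram φ (markedSingle f hf))
        (linearArrow (η := maximal 1) lt01) rfl)
      exact (mapDiagram_map (η := maximal 1) (markedSingle f hf) lt01).trans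
        (mapPrefunctor_map φ f).symm)

instance : nerve.{u}.Full where
  map_surjective {C D} φ := by
    refine ⟨ofNerveMap φ, ?_⟩
    ext η K
    refine hom_ext (fun a => ?_) ?_
    · exact (mapDiagram_obj K a.pos).symm
    · rintro ⟨a⟩ ⟨b⟩ ⟨⟨h⟩⟩
      exact (mapPrefunctor_map φ _).trans (mapDiagram_map K h).symm

end Full

end RelSemiCat

/-! ### The Segal condition in terms of elements. -/

namespace FatDelta

open Opposite

variable {P : FatDeltaᵒᵖ ⥤ Type u}

/-- The restriction of an element of a presheaf to a position. -/
noncomputable def vert {η : FatDelta} (p : P.obj (op η)) (a : Fin (η.dom.len + 1)) :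
    P.obj (op (minimal 0)) := P.map (vertex a).op p

/-- The restriction of an element of a presheaf to an increasing pair of positions. -/
noncomputable def edge {η : FatDelta} (p : P.obj (op η)) {a b : Fin (η.dom.len + 1)}
    (h : a < b) : P.obj (op (minimal 1)) := P.map (arrow h).op p

lemma vert_map {η θ : FatDelta} (f : η ⟶ θ) (p : P.obj (op θ)) (a) :
    vert (P.map f.op p) a = vert p (topFun f a) := by
  rw [vert, vert, ← vertex_comp, op_comp, Functor.map_comp_apply]

lemma edge_map {η θ : FatDelta} (f : η ⟶ θ) (p : P.obj (op θ)) {a b} (h : a < b) :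
    edge (P.map f.op p) h = edge p (topFun_lt f h) := by
  rw [edge, edge, ← arrow_comp, op_comp, Functor.map_comp_apply]

/-- The source of an arrow of a presheaf. -/
noncomputable def src (x : P.obj (op (minimal 1))) : P.obj (op (minimal 0)) :=
  vert x (0 : Fin 2)

/-- The target of an arrow of a presheaf. -/
noncomputable def tgt (x : P.obj (op (minimal 1))) : P.obj (op (minimal 0)) :=
  vert x (1 : Fin 2)

lemma src_edge {η : FatDelta} (p : P.obj (op η)) {a b : Fin (η.dom.len + 1)} (h : a < b) :
    src (edge p h) = vert p a := vert_map _ _ _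

lemma tgt_edge {η : FatDelta} (p : P.obj (op η)) {a b : Fin (η.dom.len + 1)} (h : a < b) :
    tgt (edge p h) = vert p b := vert_map _ _ _

variable (P) in
/-- The marked arrows of a presheaf. -/
def markedArrows : Set (P.obj (op (minimal 1))) := Set.range (P.map mark.op)

lemma edge_mem_markedArrows {η : FatDelta} (p : P.obj (op η)) {a b : Fin (η.dom.len + 1)}
    (h : a < b) (hc : η.Collapses a b) : edge p h ∈ markedArrows P :=
  ⟨P.map (markedArrow h hc).op p, by
    rw [edge, ← mark_comp_markedArrow h hc, op_comp, Functor.map_comp_apply]⟩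

lemma lt_of_eq_succ {n : ℕ} {a b : Fin n} (h : (b : ℕ) = a + 1) : a < b :=
  Fin.lt_def.2 (h ▸ Nat.lt_succ_self _)

variable (P) in
/-- The elementwise Segal condition: elements of `P` over `η` are the linear diagrams of shape
`η` in the underlying relative graph of `P`. -/
structure IsSegal : Prop where
  ext {η : FatDelta} {p q : P.obj (op η)} (hv : ∀ a, vert p a = vert q a)
    (he : ∀ (a b : Fin (η.dom.len + 1)) (h : (b : ℕ) = a + 1),
      edge p (lt_of_eq_succ h) = edge q (lt_of_eq_succ h)) : p = q
  exists_glue {η : FatDelta} (v : Fin (η.dom.len + 1) → P.obj (op (minimal 0)))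
    (e : ∀ a b : Fin (η.dom.len + 1), (b : ℕ) = a + 1 → P.obj (op (minimal 1)))
    (hs : ∀ a b h, src (e a b h) = v a) (ht : ∀ a b h, tgt (e a b h) = v b)
    (hm : ∀ a b h, η.Collapses a b → e a b h ∈ markedArrows P) :
    ∃ p : P.obj (op η), (∀ a, vert p a = v a) ∧
      ∀ a b h, edge p (lt_of_eq_succ h) = e a b h

section Graph

variable {X : RelGraph.{u}}

/-- The isomorphism `e` is natural only along inert maps; consecutive arrows, vertices and `mark`
are inert, and nothing else is needed. -/
lemma inert_of_eq_succ {η : FatDelta} {a b : Fin (η.dom.len + 1)} (h : (b : ℕ) = a + 1) :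
    inert (arrow (lt_of_eq_succ h)) := by
  intro i j hij
  change Fin 2 at i j
  match i, j, hij with
  | 0, 1, _ => exact h
  | 0, 0, h => exact absurd h (by decide)
  | 1, 0, h => exact absurd h (by decide)
  | 1, 1, h => exact absurd h (by decide)

lemma inert_vertex {η : FatDelta} (a : Fin (η.dom.len + 1)) : inert (vertex a) := by
  intro i j hij
  have : i = j := Subsingleton.elim (α := Fin 1) i j
  omega

lemma inert_mark : inert mark := fun _ _ h => h

variable (e : RelGraph.nerve.{u}.obj X ≅ FatDeltaInert.incl.op ⋙ P)

/-- The linear diagram of an element of a presheaf whose restriction is a nerve. -/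
def diagram {η : FatDelta} (p : P.obj (op η)) :
    FatDeltaInert.toRelGraph.{u}.obj ⟨η⟩ ⟶ X :=
  e.inv.app (op ⟨η⟩) p

/-- The element of a presheaf whose restriction is a nerve on a linear diagram. -/
def ofDiagram {η : FatDelta} (F : FatDeltaInert.toRelGraph.{u}.obj ⟨η⟩ ⟶ X) : P.obj (op η) :=
  e.hom.app (op ⟨η⟩) F

lemma diagram_ofDiagram {η : FatDelta} (F : FatDeltaInert.toRelGraph.{u}.obj ⟨η⟩ ⟶ X) :
    diagram e (ofDiagram e F) = F :=
  types_congr_hom (e.hom_inv_id_app (op ⟨η⟩)) F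

lemma ofDiagram_diagram {η : FatDelta} (p : P.obj (op η)) : ofDiagram e (diagram e p) = p :=
  types_congr_hom (e.inv_hom_id_app (op ⟨η⟩)) p

lemma diagram_map {η θ : FatDelta} (f : η ⟶ θ) (hf : inert f) (p : P.obj (op θ)) :
    diagram e (P.map f.op p) = FatDeltaInert.toRelGraph.{u}.map
      (X := ⟨η⟩) (Y := ⟨θ⟩) ⟨f, hf⟩ ≫ diagram e p :=
  types_congr_hom (e.inv.naturality
    (Quiver.Hom.op (V := FatDeltaInert) (X := ⟨η⟩) (Y := ⟨θ⟩) ⟨f, hf⟩)) p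

/-- The vertex of `X` corresponding to an element over the point. -/
def toVert (x : P.obj (op (minimal 0))) : X.Vert :=
  (RelGraph.Hom.toPrefunctor (diagram e x)).obj ⟨(0 : Fin 1)⟩

/-- An edge of the linear graph. -/
def graphEdge {η : FatDelta} {a b : Fin (η.dom.len + 1)} (h : (b : ℕ) = a + 1) :
    (⟨a⟩ : GraphVertex.{u} η) ⟶ ⟨b⟩ := ⟨⟨h⟩⟩

/-- The value of a linear diagram on an edge, with its end points. -/
def totalMap {η : FatDelta} (F : FatDeltaInert.toRelGraph.{u}.obj ⟨η⟩ ⟶ X)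
    {a b : Fin (η.dom.len + 1)} (h : (b : ℕ) = a + 1) : Quiver.Total X.Vert :=
  ⟨_, _, (RelGraph.Hom.toPrefunctor F).map (graphEdge h)⟩

lemma one_eq_succ : ((1 : Fin 2) : ℕ) = ((0 : Fin ((minimal 1).dom.len + 1)) : ℕ) + 1 := rfl

/-- The edge of `X` corresponding to an element over the free arrow. -/
def toTotal (x : P.obj (op (minimal 1))) : Quiver.Total X.Vert :=
  totalMap (diagram e x) (η := minimal 1) (a := (0 : Fin 2)) (b := (1 : Fin 2)) one_eq_succ

lemma diagram_obj {η : FatDelta} (p : P.obj (op η)) (a) :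
    (RelGraph.Hom.toPrefunctor (diagram e p)).obj ⟨a⟩ = toVert e (vert p a) := by
  rw [toVert, vert, diagram_map e _ (inert_vertex a)]
  rfl

lemma totalMap_diagram {η : FatDelta} (p : P.obj (op η)) {a b : Fin (η.dom.len + 1)}
    (h : (b : ℕ) = a + 1) :
    totalMap (diagram e p) h = toTotal e (edge p (lt_of_eq_succ h)) := by
  rw [toTotal, edge, diagram_map e _ (inert_of_eq_succ h)]
  rfl

lemma diagram_injective {η : FatDelta} {p q : P.obj (op η)} (h : diagram e p = diagram e q) :
    p = q := by
  rw [← ofDiagram_diagram e p, h, ofDiagram_diagram]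

lemma toVert_injective : Function.Injective (toVert e) := by
  intro x y h
  refine diagram_injective e (RelGraph.hom_ext ?_ ?_)
  · rintro ⟨a⟩
    obtain rfl : a = (0 : Fin 1) := Subsingleton.elim (α := Fin 1) _ _
    exact h
  · rintro a b ⟨⟨hab⟩⟩
    have : a.pos = b.pos := Subsingleton.elim (α := Fin 1) _ _
    omega

lemma toTotal_injective : Function.Injective (toTotal e) := by
  intro x y h
  refine diagram_injective e (RelGraph.hom_ext ?_ ?_)
  · rintro ⟨a⟩
    change Fin 2 at a
    match a with
    | 0 => exact congrArg Quiver.Total.left h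
    | 1 => exact congrArg Quiver.Total.right h
  · rintro ⟨a⟩ ⟨b⟩ ⟨⟨hab⟩⟩
    change Fin 2 at a b
    match a, b, hab with
    | 0, 1, _ => exact h
    | 0, 0, h => exact absurd h (by decide)
    | 1, 0, h => exact absurd h (by decide)
    | 1, 1, h => exact absurd h (by decide)

lemma toTotal_left (x : P.obj (op (minimal 1))) : (toTotal e x).left = toVert e (src x) :=
  diagram_obj e x (0 : Fin 2)

lemma toTotal_right (x : P.obj (op (minimal 1))) : (toTotal e x).right = toVert e (tgt x) :=
  diagram_obj e x (1 : Fin 2)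

lemma toTotal_hom_mem {x : P.obj (op (minimal 1))} (hx : x ∈ markedArrows P) :
    (toTotal e x).hom ∈ X.marked (toTotal e x).left (toTotal e x).right := by
  obtain ⟨m, rfl⟩ := hx
  rw [toTotal, diagram_map e _ inert_mark]
  exact RelGraph.Hom.map_mem (diagram e m)
    (graphEdge (η := maximal 1) (a := (0 : Fin 2)) (b := (1 : Fin 2)) rfl) rfl

include e in
/-- A presheaf whose restriction is a nerve satisfies the Segal condition. -/
lemma isSegal_of_iso : IsSegal P where
  ext {η p q} hv he := by
    refine diagram_injective e (RelGraph.hom_ext ?_ ?_)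
    · rintro ⟨a⟩
      exact (diagram_obj e p a).trans ((congrArg _ (hv a)).trans (diagram_obj e q a).symm)
    · rintro ⟨a⟩ ⟨b⟩ ⟨⟨h⟩⟩
      exact (totalMap_diagram e p h).trans
        ((congrArg _ (he a b h)).trans (totalMap_diagram e q h).symm)
  exists_glue {η} v t hs ht hm := by
    have key (a b : Fin (η.dom.len + 1)) (h : (b : ℕ) = a + 1) :
        ∃ g : toVert e (v a) ⟶ toVert e (v b),
          (⟨_, _, g⟩ : Quiver.Total X.Vert) = toTotal e (t a b h) :=
      Quiver.Total.exists_mk_eq _ (by rw [toTotal_left, hs]) (by rw [toTotal_right, ht])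
    choose g hg using key
    let F : FatDeltaInert.toRelGraph.{u}.obj ⟨η⟩ ⟶ X := RelGraph.Hom.mk
      { obj := fun a => toVert e (v a.pos)
        map := fun {a b} f => g a.pos b.pos f.down.down }
      (fun f hf => Quiver.Total.mem_of_mk_eq (hg _ _ _).symm (toTotal_hom_mem e (hm _ _ _ hf)))
    -- Vertices and arrows of `P` are compared through their images in `X`.
    refine ⟨ofDiagram e F, fun a => toVert_injective e ?_, fun a b h => toTotal_injective e ?_⟩
    · rw [← diagram_obj, diagram_ofDiagram]
    · rw [← totalMap_diagram e _ h, diagram_ofDiagram]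
      exact hg a b h

end Graph

end FatDelta

/-! ### Composition in a Segal presheaf. -/

namespace FatDelta

open Opposite

variable {P : FatDeltaᵒᵖ ⥤ Type u}

variable (P) in
/-- The third argument is the composite of the first two arrows of a presheaf, as witnessed by a
triangle. -/
def IsComposite (x y z : P.obj (op (minimal 1))) : Prop :=
  ∃ t : P.obj (op (minimal 2)),
    edge t (a := (0 : Fin 3)) (b := (1 : Fin 3)) (by decide : (0 : Fin 3) < 1) = x ∧
    edge t (a := (1 : Fin 3)) (b := (2 : Fin 3)) (by decide : (1 : Fin 3) < 2) = y ∧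
    edge t (a := (0 : Fin 3)) (b := (2 : Fin 3)) (by decide : (0 : Fin 3) < 2) = z

lemma isComposite_edge {η : FatDelta} (p : P.obj (op η)) {a b c : Fin (η.dom.len + 1)}
    (h : a < b) (h' : b < c) : IsComposite P (edge p h) (edge p h') (edge p (h.trans h')) :=
  ⟨P.map (triangle h h').op p, edge_map _ _ _, edge_map _ _ _, edge_map _ _ _⟩

namespace IsComposite

variable {x y z : P.obj (op (minimal 1))}

lemma tgt_eq_src (h : IsComposite P x y z) : tgt x = src y := by
  obtain ⟨t, rfl, rfl, rfl⟩ := h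
  exact (tgt_edge t _).trans (src_edge t _).symm

lemma src_eq (h : IsComposite P x y z) : src z = src x := by
  obtain ⟨t, rfl, rfl, rfl⟩ := h
  exact (src_edge t _).trans (src_edge t _).symm

lemma tgt_eq (h : IsComposite P x y z) : tgt z = tgt y := by
  obtain ⟨t, rfl, rfl, rfl⟩ := h
  exact (tgt_edge t _).trans (tgt_edge t _).symm

end IsComposite

namespace IsSegal

variable (hP : IsSegal P)

section Composition

include hP

/-- The witnessing triangle is determined by its two consecutive edges, hence so is its long edge.
-/
lemma isComposite_unique {x y z z' : P.obj (op (minimal 1))} (h : IsComposite P x y z)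
    (h' : IsComposite P x y z') : z = z' := by
  obtain ⟨t, h1, h2, rfl⟩ := h
  obtain ⟨t', h1', h2', rfl⟩ := h'
  have e1 := h1.trans h1'.symm
  have e2 := h2.trans h2'.symm
  congr 1
  refine hP.ext (fun a => ?_) fun a b h => ?_
  · change Fin 3 at a
    match a with
    | 0 => exact (src_edge t _).symm.trans ((congrArg src e1).trans (src_edge t' _))
    | 1 => exact (src_edge t _).symm.trans ((congrArg src e2).trans (src_edge t' _))
    | 2 => exact (tgt_edge t _).symm.trans ((congrArg tgt e2).trans (tgt_edge t' _))
  · change Fin 3 at a b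
    match a, b, h with
    | 0, 1, _ => exact e1
    | 1, 2, _ => exact e2
    | 0, 0, h => exact absurd h (by decide)
    | 0, 2, h => exact absurd h (by decide)
    | 1, 0, h => exact absurd h (by decide)
    | 1, 1, h => exact absurd h (by decide)
    | 2, 0, h => exact absurd h (by decide)
    | 2, 1, h => exact absurd h (by decide)
    | 2, 2, h => exact absurd h (by decide)

/-- A composable string of arrows of a Segal presheaf comes from an element over a linear
object, provided that the collapsed arrows are marked. -/
lemma exists_of_string {η : FatDelta} (x : Fin η.dom.len → P.obj (op (minimal 1)))
    (hx : ∀ i j : Fin η.dom.len, (j : ℕ) = i + 1 → tgt (x i) = src (x j))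
    (hm : ∀ i, η.Collapses i.castSucc i.succ → x i ∈ markedArrows P) (hn : 0 < η.dom.len) :
    ∃ p : P.obj (op η), ∀ i, edge p (Fin.castSucc_lt_succ (i := i)) = x i := by
  -- Each vertex is the source of the arrow leaving it, except the last, which is the target of the
  -- last arrow; `hn` provides that arrow.
  let v : Fin (η.dom.len + 1) → P.obj (op (minimal 0)) := fun a =>
    if h : (a : ℕ) < η.dom.len then src (x ⟨a, h⟩) else tgt (x ⟨η.dom.len - 1, by omega⟩)
  obtain ⟨p, -, hp⟩ := hP.exists_glue (η := η) v (fun a b h => x ⟨a, by omega⟩)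
    (fun a b h => (show v a = _ from dif_pos (by omega)).symm)
    (fun a b h => by
      by_cases h' : (b : ℕ) < η.dom.len
      · rw [show v b = _ from dif_pos h']
        exact hx _ _ h
      · rw [show v b = _ from dif_neg h']
        congr 3
        omega)
    (fun a b h hc => hm _ (by
      rwa [show b = Fin.succ ⟨a, by omega⟩ from Fin.ext h] at hc))
  exact ⟨p, fun i => hp i.castSucc i.succ rfl⟩

lemma exists_isComposite {x y : P.obj (op (minimal 1))} (h : tgt x = src y) :
    ∃ z, IsComposite P x y z := by
  obtain ⟨t, ht⟩ := hP.exists_of_string (η := minimal 2) ![x, y] (by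
    intro i j hij
    change Fin 2 at i j
    match i, j, hij with
    | 0, 1, _ => exact h
    | 0, 0, h => exact absurd h (by decide)
    | 1, 0, h => exact absurd h (by decide)
    | 1, 1, h => exact absurd h (by decide))
    (fun i hc => absurd hc (Fin.castSucc_lt_succ (i := i)).ne) Nat.zero_lt_two
  exact ⟨_, t, ht (0 : Fin 2), ht (1 : Fin 2), rfl⟩

/-- The pair also fills to an element over `maximal 2`, whose long edge is collapsed and so marked;
uniqueness identifies it with `z`. -/
lemma isComposite_mem_markedArrows {x y z : P.obj (op (minimal 1))} (h : IsComposite P x y z)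
    (hx : x ∈ markedArrows P) (hy : y ∈ markedArrows P) : z ∈ markedArrows P := by
  obtain ⟨t, ht⟩ := hP.exists_of_string (η := maximal 2) ![x, y] (by
    intro i j hij
    change Fin 2 at i j
    match i, j, hij with
    | 0, 1, _ => exact h.tgt_eq_src
    | 0, 0, h => exact absurd h (by decide)
    | 1, 0, h => exact absurd h (by decide)
    | 1, 1, h => exact absurd h (by decide))
    (fun i _ => by
      change Fin 2 at i
      match i with
      | 0 => exact hx
      | 1 => exact hy) Nat.zero_lt_two
  have h' := isComposite_edge t (a := (0 : Fin 3)) (b := (1 : Fin 3)) (c := (2 : Fin 3))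
    (by decide : (0 : Fin 3) < 1) (by decide : (1 : Fin 3) < 2)
  obtain rfl : _ = x := ht (0 : Fin 2)
  obtain rfl : _ = y := ht (1 : Fin 2)
  rw [hP.isComposite_unique h h']
  exact edge_mem_markedArrows _ _ rfl

/-- Both bracketings equal the edge from 0 to 3 of the element over `minimal 3` filling the string.
-/
lemma isComposite_assoc {x y z xy yz w w' : P.obj (op (minimal 1))} (h : IsComposite P x y xy)
    (h' : IsComposite P y z yz) (hw : IsComposite P xy z w) (hw' : IsComposite P x yz w') :
    w = w' := by
  obtain ⟨t, ht⟩ := hP.exists_of_string (η := minimal 3) ![x, y, z] (by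
    intro i j hij
    change Fin 3 at i j
    match i, j, hij with
    | 0, 1, _ => exact h.tgt_eq_src
    | 1, 2, _ => exact h'.tgt_eq_src
    | 0, 0, h => exact absurd h (by decide)
    | 0, 2, h => exact absurd h (by decide)
    | 1, 0, h => exact absurd h (by decide)
    | 1, 1, h => exact absurd h (by decide)
    | 2, 0, h => exact absurd h (by decide)
    | 2, 1, h => exact absurd h (by decide)
    | 2, 2, h => exact absurd h (by decide))
    (fun i hc => absurd hc (Fin.castSucc_lt_succ (i := i)).ne) (Nat.succ_pos 2)
  obtain rfl := ht (0 : Fin 3)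
  obtain rfl := ht (1 : Fin 3)
  obtain rfl := ht (2 : Fin 3)
  obtain rfl := hP.isComposite_unique h (isComposite_edge t _ _)
  obtain rfl := hP.isComposite_unique h' (isComposite_edge t _ _)
  rw [hP.isComposite_unique hw (isComposite_edge t _ _),
    hP.isComposite_unique hw' (isComposite_edge t _ _)]

end Composition

/-! ### Reconstruction of a Segal presheaf as a nerve. -/

/-- The relative semicategory of a Segal presheaf. -/
noncomputable def toRelSemiCat : RelSemiCat.{u} where
  Obj := P.obj (op (minimal 0))
  semicategory :=
    { Hom := fun a b => {x : P.obj (op (minimal 1)) // src x = a ∧ tgt x = b}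
      comp := fun f g =>
        ⟨(hP.exists_isComposite (f.2.2.trans g.2.1.symm)).choose,
          (hP.exists_isComposite (f.2.2.trans g.2.1.symm)).choose_spec.src_eq.trans f.2.1,
          (hP.exists_isComposite (f.2.2.trans g.2.1.symm)).choose_spec.tgt_eq.trans g.2.2⟩
      assoc := fun _ _ _ => Subtype.ext
        (hP.isComposite_assoc (Exists.choose_spec _) (Exists.choose_spec _)
          (Exists.choose_spec _) (Exists.choose_spec _)) }
  marked := fun _ _ => {f | f.1 ∈ markedArrows P}
  comp_mem _ _ hf hg := hP.isComposite_mem_markedArrows (Exists.choose_spec _) hf hg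

/-- The element over the free arrow given by an arrow of the relative semicategory of a Segal
presheaf. -/
def arrowVal {a b : hP.toRelSemiCat.Obj} (f : a ⟶ b) : P.obj (op (minimal 1)) :=
  Subtype.val (p := fun x : P.obj (op (minimal 1)) => src x = a ∧ tgt x = b) f

lemma src_arrowVal {a b : hP.toRelSemiCat.Obj} (f : a ⟶ b) : src (hP.arrowVal f) = a :=
  f.2.1

lemma tgt_arrowVal {a b : hP.toRelSemiCat.Obj} (f : a ⟶ b) : tgt (hP.arrowVal f) = b :=
  f.2.2

lemma isComposite_arrowVal {a b c : hP.toRelSemiCat.Obj} (f : a ⟶ b) (g : b ⟶ c) :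
    IsComposite P (hP.arrowVal f) (hP.arrowVal g) (hP.arrowVal (Semicategory.comp f g)) :=
  Exists.choose_spec
    (hP.exists_isComposite ((hP.tgt_arrowVal f).trans (hP.src_arrowVal g).symm))

lemma arrowVal_injective {a b : hP.toRelSemiCat.Obj} :
    Function.Injective (hP.arrowVal (a := a) (b := b)) := Subtype.val_injective

lemma total_eq {a b a' b' : hP.toRelSemiCat.Obj} {f : a ⟶ b} {f' : a' ⟶ b'}
    (h : hP.arrowVal f = hP.arrowVal f') :
    (⟨_, _, f⟩ : Quiver.Total hP.toRelSemiCat.Obj) = ⟨_, _, f'⟩ := by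
  obtain rfl : a = a' := by rw [← hP.src_arrowVal f, h, src_arrowVal]
  obtain rfl : b = b' := by rw [← hP.tgt_arrowVal f, h, tgt_arrowVal]
  rw [hP.arrowVal_injective h]

/-- The arrow of the relative semicategory of a Segal presheaf given by an increasing pair of
positions of an element. -/
noncomputable def arrowOf {η : FatDelta} (p : P.obj (op η)) {a b : Fin (η.dom.len + 1)}
    (h : a < b) : (show hP.toRelSemiCat.Obj from vert p a) ⟶ vert p b :=
  ⟨edge p h, src_edge _ _, tgt_edge _ _⟩

/-- The diagram in the relative semicategory of a Segal presheaf given by an element. -/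
noncomputable def diagramOf {η : FatDelta} (p : P.obj (op η)) :
    FatDelta.toRelSemiCat.{u}.obj η ⟶ hP.toRelSemiCat :=
  RelSemiCat.Hom.mk
    { obj := fun a => vert p a.pos
      map := fun f => hP.arrowOf p f.down.down }
    (fun f g => hP.arrowVal_injective <| hP.isComposite_unique
      (isComposite_edge p f.down.down g.down.down)
      (hP.isComposite_arrowVal (hP.arrowOf p f.down.down) (hP.arrowOf p g.down.down)))
    (fun f hf => edge_mem_markedArrows p f.down.down hf)

lemma diagramOf_map {η θ : FatDelta} (f : η ⟶ θ) (p : P.obj (op θ)) :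
    hP.diagramOf (P.map f.op p) = FatDelta.toRelSemiCat.{u}.map f ≫ hP.diagramOf p :=
  RelSemiCat.hom_ext (fun a => vert_map f p a.pos) fun g =>
    hP.total_eq (edge_map f p g.down.down)

lemma diagramOf_injective (η : FatDelta) :
    Function.Injective (hP.diagramOf (η := η)) := by
  intro p q h
  refine hP.ext (fun a => ?_) fun a b hab => ?_
  · exact congrArg (fun K : FatDelta.toRelSemiCat.{u}.obj η ⟶ hP.toRelSemiCat =>
      (RelSemiCat.prefunctor K).obj ⟨a⟩) h
  · exact congrArg (fun K : FatDelta.toRelSemiCat.{u}.obj η ⟶ hP.toRelSemiCat =>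
      hP.arrowVal ((RelSemiCat.prefunctor K).map (linearArrow (lt_of_eq_succ hab)))) h

lemma diagramOf_surjective (η : FatDelta) :
    Function.Surjective (hP.diagramOf (η := η)) := by
  intro K
  obtain ⟨p, hv, he⟩ := hP.exists_glue (η := η) (fun a => (RelSemiCat.prefunctor K).obj ⟨a⟩)
    (fun a b h => hP.arrowVal ((RelSemiCat.prefunctor K).map (linearArrow (lt_of_eq_succ h))))
    (fun _ _ _ => hP.src_arrowVal _) (fun _ _ _ => hP.tgt_arrowVal _)
    (fun a b h hc => RelSemiCat.Hom.map_mem K (linearArrow (lt_of_eq_succ h)) hc)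
  -- Gluing matches `K` on consecutive arrows only. Longer ones follow by induction on the end
  -- point, since both sides are composites of the same two arrows.
  have key (a : Fin (η.dom.len + 1)) (b : ℕ) (hb : b < η.dom.len + 1) (h : a < ⟨b, hb⟩) :
      edge p h = hP.arrowVal ((RelSemiCat.prefunctor K).map (linearArrow h)) := by
    induction b with
    | zero => exact absurd (Fin.lt_def.1 h) (Nat.not_lt_zero _)
    | succ b ih =>
      rcases (Nat.lt_succ_iff.1 (Fin.lt_def.1 h)).lt_or_eq with h' | h'
      · have hb' : b < η.dom.len + 1 := Nat.lt_of_succ_lt hb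
        have h1 : a < ⟨b, hb'⟩ := h'
        have h2 : (⟨b, hb'⟩ : Fin (η.dom.len + 1)) < ⟨b + 1, hb⟩ := Nat.lt_succ_self b
        have hp := isComposite_edge p h1 h2
        rw [ih hb' h1, he ⟨b, hb'⟩ ⟨b + 1, hb⟩ rfl] at hp
        refine hP.isComposite_unique hp ?_
        have := hP.isComposite_arrowVal ((RelSemiCat.prefunctor K).map (linearArrow h1))
          ((RelSemiCat.prefunctor K).map (linearArrow h2))
        have hK : hP.arrowVal ((RelSemiCat.prefunctor K).map (linearArrow h)) = _ :=
          congrArg hP.arrowVal (RelSemiCat.Hom.map_comp K (linearArrow h1) (linearArrow h2))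
        rw [hK]
        exact this
      · exact he a ⟨b + 1, hb⟩ (congrArg (· + 1) h'.symm)
  refine ⟨p, RelSemiCat.hom_ext (fun a => hv a.pos) ?_⟩
  rintro ⟨a⟩ ⟨b, hb⟩ ⟨⟨h⟩⟩
  exact hP.total_eq (key a b hb h)

/-- A Segal presheaf is the nerve of its relative semicategory. -/
noncomputable def isoNerve : P ≅ RelSemiCat.nerve.obj hP.toRelSemiCat :=
  NatIso.ofComponents
    (fun η => (Equiv.ofBijective (hP.diagramOf (η := η.unop))
      ⟨hP.diagramOf_injective _, hP.diagramOf_surjective _⟩).toIso)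
    (fun f => by
      ext p
      exact hP.diagramOf_map f.unop p)

end IsSegal

end FatDelta

theorem theorem4p15 :
    RelSemiCat.nerve.{u}.Full ∧ RelSemiCat.nerve.{u}.Faithful ∧
      ∀ P : FatDeltaᵒᵖ ⥤ Type u,
        RelSemiCat.nerve.{u}.essImage P ↔
          RelGraph.nerve.{u}.essImage (FatDeltaInert.incl.op ⋙ P) := by
  refine ⟨inferInstance, inferInstance, fun P => ⟨?_, ?_⟩⟩
  · rintro ⟨C, ⟨e⟩⟩
    exact ⟨C.toRelGraph, ⟨C.restrictNerveIso.symm ≪≫ Functor.isoWhiskerLeft _ e⟩⟩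
  · rintro ⟨X, ⟨e⟩⟩
    exact ⟨_, ⟨(FatDelta.isSegal_of_iso e).isoNerve.symm⟩⟩
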